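/- Let $m\ge 3$, put $k=m-1$, and let $K$ be a field of characteristic $0$. For a finite graph $G$ with $m$ distinct marked vertices $v_1,\dots,v_m$ and a set partition $P$ of $\{1,\dots,m\}$, write $P(G)=\sum_{F\sim P}\prod_{e\in E(G)\setminus F}a_e$ for the spanning forest polynomial, where the $a_e$ are variables indexed by the edges of $G$ and $F\sim P$ means that $F$ is a spanning forest of $G$ (isolated vertices are allowed as trees) whose trees are in bijection with the parts of $P$, so that each marked vertex lies in the tree corresponding to its part. Let $(1,1,\dots,1)$ be the partition with one part and $(1,2,\dots,m)$ the partition into singletons. An $A$ partition is a set partition of $\{1,\dots,m\}$ with $m-1$ parts, a $B$ partition is one with $2$ parts, and $V_m$ is the $K$-vector space with basis the formal monomials $AB$, one for each pair of an $A$ partition $A$ and a $B$ partition $B$. For $r,c\in\{1,\dots,m\}$ and $j\in\{1,\dots,k\}$ define $L_{r,c}(j)\in V_m$ as follows. Let $L$ be the Laplacian of the complete graph on $\{1,\dots,m\}$ with an independent variable $x_e$ as the weight of each edge $e$, let $M=L_{r,c}$ be $L$ with row $r$ and column $c$ removed, and let $M_{U,W}$ be $M$ with the rows in positions $U$ and the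 columns in positions $W$ removed. The $j$-th column expansion identity for $M$ is $$\det(M)\det(M_{[k],[k]})=\sum_{i=1}^{k}(-1)^{i+j}\det(M_{i,j})\det(M_{[k]\setminus\{i\},[k]\setminus\{j\}}).$$ By the all minors matrix tree theorem, $\det(M_{i,j})$ is a signed sum of the products $\prod_{e\in F}x_e$ over spanning forests $F$ with two trees, $\det(M_{[k]\setminus\{i\},[k]\setminus\{j\}})$ is a signed sum of such products over spanning forests with $m-1$ trees, and in each of them the coefficient ($0$ or $\pm1$) of $\prod_{e\in F}x_e$ depends only on the partition of $\{1,\dots,m\}$ into the vertex sets of the trees of $F$. So these two determinants are formal integer linear combinations of $B$ partitions and of $A$ partitions, respectively, and $L_{r,c}(j)$ is $(-1)^{r+c}$ times the right-hand side of the identity, read in this way as an element of $V_m$. (As $(-1)^{r+c}\det(L_{r,c})$ is the sum over all spanning trees, this gives the quadratic spanning forest identity $\mathcal L_{r,c}(j)$: $(1,1,\dots,1)(1,2,\dots,m)=L_{r,c}(j)$.) **Theorem.** Let $\eta\in K$ and let $\alpha_{A,B}\in K$ for all $A$ partitions $A$ and $B$ partitions $B$. Suppose that the identity $$\eta\,(1,1,\dots,1)(1,2,\dots,m)=\sum_{A,B}\alpha_{A,B}\,A\,B$$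 of spanning forest polynomials holds on every finite simple graph with $m$ distinct marked vertices. Then it is a linear combination of the identities $\mathcal L_{r,c}(j)$: there are $\varepsilon_{r,c,j}\in K$ with $$\eta=\sum_{r,c,j}\varepsilon_{r,c,j}\qquad\text{and}\qquad \sum_{A,B}\alpha_{A,B}\,AB=\sum_{r,c,j}\varepsilon_{r,c,j}\,L_{r,c}(j)\ \text{ in } V_m .$$ -/

import Mathlib

namespace SpanningForest

open Finset MvPolynomial

/-- Set partitions of the `m` marked vertices, labelled by `Fin m`.  The partition
`(1,1,…,1)` is `⊤` and the partition `(1,2,…,m)` is `⊥`. -/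
abbrev MarkedPartition (m : ℕ) : Type := Finpartition (Finset.univ : Finset (Fin m))

/-- The `A` partitions of `k + 1` marked vertices: those with exactly `k` parts
(two marked vertices together, all the others alone). -/
abbrev APartition (k : ℕ) : Type := {P : MarkedPartition (k + 1) // P.parts.card = k}

/-- The `B` partitions of `k + 1` marked vertices: those with exactly two parts. -/
abbrev BPartition (k : ℕ) : Type := {P : MarkedPartition (k + 1) // P.parts.card = 2}

/-- `F ∼ P`: the graph `F` on `V` (with all of `V` as vertices, so that isolated vertices are
trees) is a forest, and its trees are in bijection with the parts of `P` in such a way that each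
marked vertex lies in the tree of its part. -/
def Compatible {V : Type*} {m : ℕ} (v : Fin m → V) (P : MarkedPartition m)
    (F : SimpleGraph V) : Prop :=
  F.IsAcyclic ∧
    ∃ t : {p : Finset (Fin m) // p ∈ P.parts} ≃ F.ConnectedComponent,
      ∀ p, ∀ i ∈ p.1, F.connectedComponentMk (v i) = t p

open Classical in
/-- The spanning forest polynomial `∑_{F ∼ P} ∏_{e ∉ F} a_e` of the graph `G` with marked
vertices `v`, with one variable for each edge of `G`. -/
noncomputable def forestPoly (K : Type*) [CommRing K] {V : Type*} [Fintype V] {m : ℕ}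
    (G : SimpleGraph V) (v : Fin m → V) (P : MarkedPartition m) : MvPolynomial (Sym2 V) K :=
  ∑ F ∈ (Finset.univ : Finset (SimpleGraph V)).filter (fun F => F ≤ G ∧ Compatible v P F),
    ∏ e ∈ G.edgeFinset \ F.edgeFinset, X e

/-- The Laplacian of the complete graph on `Fin m`, with an independent variable as the weight of
each (undirected) edge. -/
noncomputable def genericLaplacian (m : ℕ) :
    Matrix (Fin m) (Fin m) (MvPolynomial (Sym2 (Fin m)) ℤ) :=
  Matrix.of fun i j => if i = j then ∑ l ∈ Finset.univ.erase i, X s(i, l) else -X s(i, j)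

/-- `det M_{U,W}`: the determinant of `M` with the rows in `U` and the columns in `W` removed. -/
noncomputable def minorDet {R : Type*} [CommRing R] {N : ℕ} (M : Matrix (Fin N) (Fin N) R)
    (U W : Finset (Fin N)) (h : U.card = W.card) : R :=
  (M.submatrix (Uᶜ.orderEmbOfFin rfl)
    (Wᶜ.orderEmbOfFin (by simp only [Finset.card_compl, h]))).det

/-- The least element of the part of `P` that contains `i`. -/
def root {m : ℕ} (P : MarkedPartition m) (i : Fin m) : Fin m :=
  (P.part i).min' ⟨i, P.mem_part (Finset.mem_univ i)⟩

/-- The edges of a spanning forest of the complete graph on `Fin m` whose trees have exactly the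
parts of `P` as vertex sets: each vertex is joined to the least vertex of its part. -/
def representativeForest {m : ℕ} (P : MarkedPartition m) : Finset (Sym2 (Fin m)) :=
  (Finset.univ.filter fun i => root P i ≠ i).image fun i => s(root P i, i)

/-- The coefficient of the partition `P` in a signed sum of spanning forests `q`: the sign with
which a forest of type `P` occurs in `q`.  When `q` is a minor `det L_{U,W}` of the Laplacian with
`|U| = |W|` equal to the number of parts of `P`, all the forests of type `P` occur with the same
coefficient by the all minors matrix tree theorem, so it is read off at one of them, and `q` is
the sum over such partitions `P` of this coefficient times the sum of the forests of type `P`. -/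
noncomputable def partitionCoeff {m : ℕ} (P : MarkedPartition m)
    (q : MvPolynomial (Sym2 (Fin m)) ℤ) : ℤ :=
  q.coeff (∑ e ∈ representativeForest P, Finsupp.single e 1)

/-- The Laplacian with row `r` and column `c` removed. -/
noncomputable def reducedLaplacian (k : ℕ) (r c : Fin (k + 1)) :
    Matrix (Fin k) (Fin k) (MvPolynomial (Sym2 (Fin (k + 1))) ℤ) :=
  (genericLaplacian (k + 1)).submatrix r.succAbove c.succAbove

/-- The coefficient of the monomial `A B` in `L_{r,c}(j)`, the right hand side of the spanning
forest identity `(1,1,…,1)(1,2,…,m) = L_{r,c}(j)`, where `m = k + 1`.  This identity is the column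
expansion identity
`det M * det M_{[k],[k]} = ∑ i, (-1)^(i+j) * det M_{i,j} * det M_{[k]∖{i},[k]∖{j}}`
for `M = L_{r,c}`, in which each minor is written as a signed sum of partitions: the factor
`det M_{i,j}` is a sum of `B` partitions and the factor `det M_{[k]∖{i},[k]∖{j}}` a sum of `A`
partitions.  As `det L_{r,c}` is `(-1)^(r+c)` times the sum of the spanning trees, both sides are
multiplied by `(-1)^(r+c)`. -/
noncomputable def columnL (k : ℕ) (r c : Fin (k + 1)) (j : Fin k)
    (A : APartition k) (B : BPartition k) : ℤ :=
  (-1) ^ ((r : ℕ) + (c : ℕ)) *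
    ∑ i : Fin k, (-1) ^ ((i : ℕ) + (j : ℕ)) *
      partitionCoeff B.1 (minorDet (reducedLaplacian k r c) {i} {j} (by simp)) *
      partitionCoeff A.1 (minorDet (reducedLaplacian k r c) (Finset.univ \ {i})
        (Finset.univ \ {j}) (by simp [Finset.card_sdiff]))

end SpanningForest

/-!
Only finite graphs all of whose vertices are marked, and among them only trees, are needed. On a
tree `G` the forests below `G` correspond to the partitions with connected parts, and the identity
reduces to
`η ∏ a_z = ∑ x, ∑ y, α (A x) (B y) (∏ z ≠ x, a_z) a_y`, where `x`, `y`, `z` run through the edges,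
`A x` joins the ends of the edge `x`, and `B x` is the cut that the removal of `x` leaves.
Hence `∑ x, α (A x) (B x) = η` (`IsRootedTree.sum_extendCoeff`), and `α (A x) (B y) = 0` for
`x ≠ y` (`IsRootedTree.extendCoeff_eq_zero`).

These relations are applied to double stars with centers `a`, `b`. The second one says that the
coefficient of the pair `u`, `v` and the cut `S` vanishes unless `S` separates `u` from `v`. Write
`f a b S` for this coefficient when `a ∈ S` and `b ∉ S`, and `φ x y = f x y {x}`. The first
relation is `f a b S + ∑ x ∈ S \ {a}, φ x a + ∑ x ∉ S ∪ {b}, φ x b = η`; for `S = {a}` it says that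
`∑ x ≠ b, φ x b = η`, and together these give
`f a b S = ∑ x ∈ S, φ x b + ∑ x ∉ S, φ x a - η` (`extendCoeff_eq`).

On the other side, the cofactors of the Laplacian with row and column `c` removed are computed from
the factorization `Nᵀ D N` of the Laplacian of a forest, with `N` the unimodular incidence matrix of
a tree rooted at `c` (`adjugate_map_reducedLaplacian`). It follows (`columnL_self`) that the
coefficient of the pair `a`, `b` and the cut `S` in `L_{c,c}(j)`, with `d` the vertex of the
column `j`, is `1` if `d` is one of `a`, `b`, the cut separates `a` from `b`, and `c` lies on the
side of the one that is not `d`; otherwise it is `0`. So the formula for `f` is the required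
linear combination, with `φ c d - η / (k + 1)` as the coefficient of `L_{c,c}(j)`.
-/

namespace SpanningForest

open Finset MvPolynomial

/-! ### Partitions of the marked vertices -/

lemma part_eq_of_mem_part {m : ℕ} {P : MarkedPartition m} {i j : Fin m} :
    j ∈ P.part i ↔ P.part i = P.part j := by
  rw [Finpartition.mem_part_iff_part_eq_part P (mem_univ j) (mem_univ i)]
  exact eq_comm

lemma part_mem_parts {m : ℕ} (P : MarkedPartition m) (i : Fin m) : P.part i ∈ P.parts :=
  (P.part_mem).2 (mem_univ i)

/-- A partition that refines another one with at least as many parts is equal to it. -/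
lemma eq_of_refines {m : ℕ} {P Q : MarkedPartition m}
    (h : ∀ i j, P.part i = P.part j → Q.part i = Q.part j)
    (hc : P.parts.card ≤ Q.parts.card) : P = Q := by
  classical
  let f : Finset (Fin m) → Finset (Fin m) := fun p =>
    if hp : p.Nonempty then Q.part (p.min' hp) else ∅
  have hf : ∀ i, f (P.part i) = Q.part i := by
    intro i
    have hne : (P.part i).Nonempty := ⟨i, P.mem_part (mem_univ i)⟩
    simp only [f, dif_pos hne]
    exact (h _ _ (part_eq_of_mem_part.1 (min'_mem _ hne))).symm
  have hmaps : Set.MapsTo f P.parts Q.parts := by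
    intro p hp
    obtain ⟨i, -, rfl⟩ := P.part_surjOn hp
    rw [hf]; exact part_mem_parts Q i
  have hsurj : Set.SurjOn f P.parts Q.parts := by
    intro q hq
    obtain ⟨i, -, rfl⟩ := Q.part_surjOn hq
    exact ⟨P.part i, part_mem_parts P i, hf i⟩
  have hinj : Set.InjOn f P.parts := injOn_of_surjOn_of_card_le f hmaps hsurj hc
  have hiff : ∀ i, P.part i = Q.part i := by
    intro i
    ext j
    rw [part_eq_of_mem_part, part_eq_of_mem_part]
    refine ⟨h i j, fun hij => hinj (part_mem_parts P i) (part_mem_parts P j) ?_⟩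
    rw [hf, hf, hij]
  ext p
  constructor
  · intro hp
    obtain ⟨i, -, rfl⟩ := P.part_surjOn hp
    rw [hiff]; exact part_mem_parts Q i
  · intro hp
    obtain ⟨i, -, rfl⟩ := Q.part_surjOn hp
    rw [← hiff]; exact part_mem_parts P i

lemma ext_part {m : ℕ} {P Q : MarkedPartition m}
    (h : ∀ i j, P.part i = P.part j ↔ Q.part i = Q.part j) : P = Q := by
  rcases le_total P.parts.card Q.parts.card with hc | hc
  · exact eq_of_refines (fun i j => (h i j).1) hc
  · exact (eq_of_refines (fun i j => (h i j).2) hc).symm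

/-- The partition of the marked vertices into the nonempty fibres of `f`. -/
noncomputable def fiberPartition {m : ℕ} {β : Type*} [DecidableEq β] (f : Fin m → β) :
    MarkedPartition m :=
  haveI : DecidableRel (Setoid.ker f).r := fun i j => decEq (f i) (f j)
  Finpartition.ofSetoid (Setoid.ker f)

lemma part_fiberPartition {m : ℕ} {β : Type*} [DecidableEq β] (f : Fin m → β) (i j : Fin m) :
    (fiberPartition f).part i = (fiberPartition f).part j ↔ f i = f j := by
  rw [← part_eq_of_mem_part]
  exact @Finpartition.mem_part_ofSetoid_iff_rel _ _ _ _ (Setoid.ker f)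
    (fun i j => decEq (f i) (f j)) _

lemma card_parts_fiberPartition {m : ℕ} {β : Type*} [DecidableEq β] (f : Fin m → β) :
    (fiberPartition f).parts.card = (univ.image f).card := by
  have hpart : ∀ i, (fiberPartition f).part i = univ.filter fun j => f i = f j := by
    intro i
    ext j
    rw [part_eq_of_mem_part, part_fiberPartition, mem_filter]
    simp
  have hp : (fiberPartition f).parts =
      (univ.image f).image fun y => univ.filter fun j => y = f j := by
    ext p
    rw [image_image, mem_image]
    constructor
    · intro hp
      obtain ⟨i, -, rfl⟩ := (fiberPartition f).part_surjOn hp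
      exact ⟨i, mem_univ i, (hpart i).symm⟩
    · rintro ⟨i, -, rfl⟩
      rw [Function.comp_apply, ← hpart]
      exact part_mem_parts _ i
  rw [hp, card_image_of_injOn]
  intro y hy z _ h
  obtain ⟨i, -, rfl⟩ := mem_image.1 hy
  have h' : (univ.filter fun j => f i = f j) = univ.filter fun j => z = f j := h
  have : i ∈ univ.filter fun j => z = f j := by
    rw [← h']
    simp
  exact (mem_filter.1 this).2.symm

/-- The `A` partition that joins the marked vertices `u` and `v`. -/
noncomputable def pairPartition {m : ℕ} (u v : Fin m) : MarkedPartition m :=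
  fiberPartition fun x => if x = u then v else x

/-- The `B` partition into `S` and its complement. -/
noncomputable def cutPartition {m : ℕ} (S : Finset (Fin m)) : MarkedPartition m :=
  fiberPartition fun x => decide (x ∈ S)

lemma part_pairPartition {m : ℕ} (u v i j : Fin m) :
    (pairPartition u v).part i = (pairPartition u v).part j ↔
      i = j ∨ (i = u ∧ j = v) ∨ (i = v ∧ j = u) := by
  rw [pairPartition, part_fiberPartition]
  split_ifs <;> grind

lemma part_cutPartition {m : ℕ} (S : Finset (Fin m)) (i j : Fin m) :
    (cutPartition S).part i = (cutPartition S).part j ↔ (i ∈ S ↔ j ∈ S) := by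
  rw [cutPartition, part_fiberPartition, decide_eq_decide]

lemma pairPartition_comm {m : ℕ} (u v : Fin m) : pairPartition u v = pairPartition v u :=
  ext_part fun i j => by rw [part_pairPartition, part_pairPartition]; tauto

lemma cutPartition_compl {m : ℕ} (S : Finset (Fin m)) : cutPartition Sᶜ = cutPartition S :=
  ext_part fun i j => by
    rw [part_cutPartition, part_cutPartition, mem_compl, mem_compl, not_iff_not]

lemma card_parts_pairPartition {k : ℕ} {u v : Fin (k + 1)} (h : u ≠ v) :
    (pairPartition u v).parts.card = k := by
  have : univ.image (fun x => if x = u then v else x) = univ.erase u := by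
    ext y
    simp only [mem_image, mem_univ, true_and, mem_erase, and_true]
    constructor
    · rintro ⟨x, rfl⟩
      split_ifs with hx
      · exact h.symm
      · exact hx
    · intro hy
      exact ⟨y, if_neg hy⟩
  rw [pairPartition, card_parts_fiberPartition, this, card_erase_of_mem (mem_univ u), card_univ,
    Fintype.card_fin, Nat.add_sub_cancel]

lemma card_parts_cutPartition {m : ℕ} {S : Finset (Fin m)} {u v : Fin m} (hu : u ∈ S)
    (hv : v ∉ S) : (cutPartition S).parts.card = 2 := by
  have : univ.image (fun x => decide (x ∈ S)) = univ := by
    ext y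
    simp only [mem_image, mem_univ, true_and, iff_true]
    cases y
    · exact ⟨v, by simpa using hv⟩
    · exact ⟨u, by simpa using hu⟩
  rw [cutPartition, card_parts_fiberPartition, this]
  rfl

lemma exists_eq_pairPartition {k : ℕ} {P : MarkedPartition (k + 1)} (h : P.parts.card = k) :
    ∃ u v, u ≠ v ∧ P = pairPartition u v := by
  obtain ⟨u, -, v, -, huv, he⟩ := exists_ne_map_eq_of_card_lt_of_maps_to
    (s := (univ : Finset (Fin (k + 1)))) (t := P.parts) (f := P.part)
    (by rw [h, card_univ, Fintype.card_fin]; exact Nat.lt_succ_self k)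
    (fun i _ => part_mem_parts P i)
  refine ⟨u, v, huv, (eq_of_refines ?_ ?_).symm⟩
  · intro i j hij
    rcases (part_pairPartition u v i j).1 hij with rfl | ⟨rfl, rfl⟩ | ⟨rfl, rfl⟩
    · rfl
    · exact he
    · exact he.symm
  · rw [card_parts_pairPartition huv, h]

lemma exists_eq_cutPartition {m : ℕ} {P : MarkedPartition m} (h : P.parts.card = 2) :
    ∃ (S : Finset (Fin m)) (u v : Fin m), u ∈ S ∧ v ∉ S ∧ P = cutPartition S := by
  obtain ⟨p, hp, q, hq, hpq⟩ := one_lt_card.1 (by omega : 1 < P.parts.card)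
  obtain ⟨u, -, rfl⟩ := P.part_surjOn hp
  obtain ⟨v, -, rfl⟩ := P.part_surjOn hq
  have hu : u ∈ P.part u := part_eq_of_mem_part.2 rfl
  have hv : v ∉ P.part u := fun hv => hpq (part_eq_of_mem_part.1 hv)
  refine ⟨P.part u, u, v, hu, hv, eq_of_refines ?_ ?_⟩
  · intro i j hij
    rw [part_cutPartition, part_eq_of_mem_part, part_eq_of_mem_part, hij]
  · rw [h, card_parts_cutPartition hu hv]

lemma part_top {m : ℕ} (i j : Fin m) :
    (⊤ : MarkedPartition m).part i = (⊤ : MarkedPartition m).part j :=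
  Finpartition.parts_top_subsingleton _ (part_mem_parts ⊤ i) (part_mem_parts ⊤ j)

lemma part_bot {m : ℕ} (i j : Fin m) :
    (⊥ : MarkedPartition m).part i = (⊥ : MarkedPartition m).part j ↔ i = j := by
  refine ⟨fun h => ?_, fun h => h ▸ rfl⟩
  obtain ⟨a, -, ha⟩ := Finpartition.mem_bot_iff.1 (part_mem_parts (⊥ : MarkedPartition m) i)
  have hi := part_eq_of_mem_part.2 (rfl : (⊥ : MarkedPartition m).part i = _)
  have hj := part_eq_of_mem_part.2 h
  rw [← ha, mem_singleton] at hi hj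
  rw [hi, hj]

/-! ### Forest polynomials of trees -/

/-- The edges of `G` that join marked vertices of the same part of `P`, when all the vertices are
marked. -/
def insideGraph {m : ℕ} (G : SimpleGraph (Fin m)) (P : MarkedPartition m) :
    SimpleGraph (Fin m) where
  Adj i j := G.Adj i j ∧ P.part i = P.part j
  symm := ⟨fun _ _ h => ⟨h.1.symm, h.2.symm⟩⟩
  loopless := ⟨fun _ h => h.1.ne rfl⟩

lemma insideGraph_le {m : ℕ} (G : SimpleGraph (Fin m)) (P : MarkedPartition m) :
    insideGraph G P ≤ G := fun _ _ h => h.1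

lemma part_eq_of_reachable_insideGraph {m : ℕ} {G : SimpleGraph (Fin m)} {P : MarkedPartition m}
    {i j : Fin m} (h : (insideGraph G P).Reachable i j) : P.part i = P.part j := by
  obtain ⟨w⟩ := h
  induction w with
  | nil => rfl
  | cons h _ ih => exact h.2.trans ih

/-- When all the vertices are marked, `F ∼ P` means that the parts of `P` are the vertex sets of
the connected components of the forest `F`. -/
lemma compatible_iff {m : ℕ} {P : MarkedPartition m} {F : SimpleGraph (Fin m)} :
    Compatible (Function.Embedding.refl (Fin m)) P F ↔
      F.IsAcyclic ∧ ∀ i j, F.Reachable i j ↔ P.part i = P.part j := by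
  refine and_congr_right fun _ => ⟨?_, fun h => ?_⟩
  · rintro ⟨t, ht⟩ i j
    have hc : ∀ i, F.connectedComponentMk i = t ⟨P.part i, part_mem_parts P i⟩ := fun i =>
      ht ⟨P.part i, part_mem_parts P i⟩ i (part_eq_of_mem_part.2 rfl)
    rw [← SimpleGraph.ConnectedComponent.eq, hc, hc, t.injective.eq_iff, Subtype.mk.injEq]
  · have hne : ∀ p : {p : Finset (Fin m) // p ∈ P.parts}, p.1.Nonempty :=
      fun p => P.nonempty_of_mem_parts p.2
    have hpart : ∀ (p : {p : Finset (Fin m) // p ∈ P.parts}) (i : Fin m), i ∈ p.1 →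
        P.part i = p.1 := fun p i hi => P.part_eq_of_mem p.2 hi
    refine ⟨Equiv.ofBijective (fun p => F.connectedComponentMk (hne p).choose) ⟨?_, ?_⟩, ?_⟩
    · intro p q hpq
      have := (h _ _).1 (SimpleGraph.ConnectedComponent.eq.1 hpq)
      rw [hpart p _ (hne p).choose_spec, hpart q _ (hne q).choose_spec] at this
      exact Subtype.ext this
    · intro c
      induction c using SimpleGraph.ConnectedComponent.ind with
      | h i =>
        refine ⟨⟨P.part i, part_mem_parts P i⟩, SimpleGraph.ConnectedComponent.eq.2 ?_⟩
        rw [h]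
        exact hpart ⟨P.part i, part_mem_parts P i⟩ _ (hne _).choose_spec
    · intro p i hi
      refine SimpleGraph.ConnectedComponent.eq.2 ?_
      rw [h]
      exact (hpart p i hi).trans (hpart p _ (hne p).choose_spec).symm

/-- A forest in the acyclic graph `G` is determined by its components. -/
lemma eq_insideGraph {m : ℕ} {G F : SimpleGraph (Fin m)} {P : MarkedPartition m}
    (hG : G.IsAcyclic) (hF : F ≤ G) (h : ∀ i j, F.Reachable i j ↔ P.part i = P.part j) :
    F = insideGraph G P := by
  ext i j
  refine ⟨fun hij => ⟨hF hij, (h i j).1 hij.reachable⟩, fun hij => ?_⟩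
  by_contra hn
  have hb := SimpleGraph.isAcyclic_iff_forall_adj_isBridge.1 hG hij.1
  rw [SimpleGraph.isBridge_iff] at hb
  refine hb (((h i j).2 hij.2).mono fun x y hxy => ?_)
  rw [SimpleGraph.deleteEdges_adj]
  refine ⟨hF hxy, fun hxy' => hn ?_⟩
  rcases Sym2.eq_iff.1 (Set.mem_singleton_iff.1 hxy') with ⟨rfl, rfl⟩ | ⟨rfl, rfl⟩
  · exact hxy
  · exact hxy.symm

open Classical in
lemma forestPoly_eq_prod {K : Type*} [CommRing K] {m : ℕ} {G : SimpleGraph (Fin m)}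
    {P : MarkedPartition m} (hG : G.IsAcyclic)
    (h : ∀ i j, P.part i = P.part j → (insideGraph G P).Reachable i j) :
    forestPoly K G (Function.Embedding.refl (Fin m)) P =
      ∏ e ∈ G.edgeFinset \ (insideGraph G P).edgeFinset, X e := by
  rw [forestPoly]
  rw [sum_eq_single_of_mem (insideGraph G P)]
  · congr!
  · simp only [mem_filter, mem_univ, true_and, compatible_iff]
    exact ⟨insideGraph_le G P, hG.anti (insideGraph_le G P),
      fun i j => ⟨part_eq_of_reachable_insideGraph, h i j⟩⟩
  · intro F hF hne
    rw [mem_filter, compatible_iff] at hF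
    exact absurd (eq_insideGraph hG hF.2.1 hF.2.2.2) hne

lemma forestPoly_eq_zero {K : Type*} [CommRing K] {m : ℕ} {G : SimpleGraph (Fin m)}
    {P : MarkedPartition m} (hG : G.IsAcyclic)
    (h : ¬ ∀ i j, P.part i = P.part j → (insideGraph G P).Reachable i j) :
    forestPoly K G (Function.Embedding.refl (Fin m)) P = 0 := by
  classical
  rw [forestPoly]
  refine sum_eq_zero fun F hF => absurd ?_ h
  rw [mem_filter, compatible_iff] at hF
  rw [← eq_insideGraph hG hF.2.1 hF.2.2.2]
  exact fun i j => (hF.2.2.2 i j).2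

/-- The graph in which every vertex other than `b` is joined to its parent. -/
def parentGraph {m : ℕ} (p : Fin m → Fin m) (b : Fin m) : SimpleGraph (Fin m) :=
  SimpleGraph.fromRel fun x y => x ≠ b ∧ p x = y

/-- `p` is the parent function of a tree with root `b`, and for each `x ≠ b` the set `U x` is
a side of the cut of the edge from `x` to its parent: this edge crosses `U x`, and it is the only
edge that does. -/
structure IsRootedTree {m : ℕ} (p : Fin m → Fin m) (b : Fin m) (U : Fin m → Finset (Fin m)) :
    Prop where
  connected : (parentGraph p b).Connected
  cross : ∀ x, x ≠ b → ∀ y, y ≠ b → ((y ∈ U x ↔ p y ∈ U x) ↔ y ≠ x)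

namespace IsRootedTree

variable {m : ℕ} {p : Fin m → Fin m} {b : Fin m} {U : Fin m → Finset (Fin m)}

lemma parent_ne (h : IsRootedTree p b U) {x : Fin m} (hx : x ≠ b) : p x ≠ x := by
  intro hp
  have := h.cross x hx x hx
  rw [hp] at this
  simp at this

lemma adj_parent (h : IsRootedTree p b U) {x : Fin m} (hx : x ≠ b) :
    (parentGraph p b).Adj x (p x) :=
  (SimpleGraph.fromRel_adj _ _ _).2 ⟨(h.parent_ne hx).symm, Or.inl ⟨hx, rfl⟩⟩

lemma edge_injOn (h : IsRootedTree p b U) {x y : Fin m} (hx : x ≠ b) (hy : y ≠ b)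
    (he : s(x, p x) = s(y, p y)) : x = y := by
  by_contra hne
  have h1 := h.cross x hx y hy
  have h2 := h.cross x hx x hx
  rcases Sym2.eq_iff.1 he with ⟨h3, h4⟩ | ⟨h3, h4⟩
  · exact hne h3
  · rw [← h3] at h1
    have hyx : y ≠ x := fun hyx => hne hyx.symm
    rw [h4] at h2
    tauto

open Classical in
lemma edgeFinset_eq (h : IsRootedTree p b U) :
    (parentGraph p b).edgeFinset = (univ.erase b).image fun x => s(x, p x) := by
  ext e
  rw [SimpleGraph.mem_edgeFinset, mem_image]
  constructor
  · induction e using Sym2.ind with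
    | _ x y =>
      intro hxy
      rw [SimpleGraph.mem_edgeSet, parentGraph, SimpleGraph.fromRel_adj] at hxy
      rcases hxy with ⟨-, ⟨hx, rfl⟩ | ⟨hy, rfl⟩⟩
      · exact ⟨x, mem_erase.2 ⟨hx, mem_univ x⟩, rfl⟩
      · exact ⟨y, mem_erase.2 ⟨hy, mem_univ y⟩, Sym2.eq_swap⟩
  · rintro ⟨x, hx, rfl⟩
    exact h.adj_parent (mem_erase.1 hx).1

lemma isAcyclic (h : IsRootedTree p b U) : (parentGraph p b).IsAcyclic := by
  classical
  refine (SimpleGraph.isTree_iff_connected_and_card.2 ⟨h.connected, ?_⟩).isAcyclic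
  rw [Nat.card_eq_fintype_card, ← SimpleGraph.edgeFinset_card, h.edgeFinset_eq,
    card_image_of_injOn, card_erase_of_mem (mem_univ b), Nat.card_eq_fintype_card, card_univ,
    Fintype.card_fin]
  · have := b.pos
    omega
  · intro x hx y hy
    exact h.edge_injOn (mem_erase.1 hx).1 (mem_erase.1 hy).1

open Classical in
/-- A partition all of whose parts are connected in the tree contributes the product of the
edges that join different parts. -/
lemma forestPoly_eq (K : Type*) [CommRing K] (h : IsRootedTree p b U) {P : MarkedPartition m}
    (hP : ∀ i j, P.part i = P.part j → (insideGraph (parentGraph p b) P).Reachable i j) :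
    forestPoly K (parentGraph p b) (Function.Embedding.refl (Fin m)) P =
      ∏ x ∈ (univ.erase b).filter (fun x => P.part x ≠ P.part (p x)), X s(x, p x) := by
  rw [forestPoly_eq_prod h.isAcyclic hP]
  have : (parentGraph p b).edgeFinset \ (insideGraph (parentGraph p b) P).edgeFinset =
      ((univ.erase b).filter fun x => P.part x ≠ P.part (p x)).image fun x => s(x, p x) := by
    rw [h.edgeFinset_eq]
    ext e
    rw [mem_sdiff, mem_image, mem_image, SimpleGraph.mem_edgeFinset]
    constructor
    · rintro ⟨⟨x, hx, rfl⟩, he⟩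
      refine ⟨x, mem_filter.2 ⟨hx, fun hp => he ?_⟩, rfl⟩
      exact ⟨h.adj_parent (mem_erase.1 hx).1, hp⟩
    · rintro ⟨x, hx, rfl⟩
      rw [mem_filter] at hx
      exact ⟨⟨x, hx.1, rfl⟩, fun he => hx.2 he.2⟩
  rw [this, prod_image]
  intro x hx y hy
  exact h.edge_injOn (mem_erase.1 (mem_filter.1 hx).1).1 (mem_erase.1 (mem_filter.1 hy).1).1

lemma forestPoly_top (K : Type*) [CommRing K] (h : IsRootedTree p b U) :
    forestPoly K (parentGraph p b) (Function.Embedding.refl (Fin m)) ⊤ = 1 := by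
  rw [h.forestPoly_eq K]
  · rw [filter_false_of_mem, prod_empty]
    intro x _ hx
    exact hx (part_top _ _)
  · intro i j _
    exact (h.connected.preconnected i j).mono fun x y hxy => ⟨hxy, part_top x y⟩

lemma forestPoly_bot (K : Type*) [CommRing K] (h : IsRootedTree p b U) :
    forestPoly K (parentGraph p b) (Function.Embedding.refl (Fin m)) ⊥ =
      ∏ x ∈ univ.erase b, X s(x, p x) := by
  rw [h.forestPoly_eq K]
  · rw [filter_true_of_mem]
    intro x hx hp
    exact h.parent_ne (mem_erase.1 hx).1 ((part_bot _ _).1 hp).symm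
  · intro i j hij
    rw [(part_bot _ _).1 hij]

lemma forestPoly_pair (K : Type*) [CommRing K] (h : IsRootedTree p b U) {x : Fin m}
    (hx : x ≠ b) :
    forestPoly K (parentGraph p b) (Function.Embedding.refl (Fin m)) (pairPartition x (p x)) =
      ∏ y ∈ (univ.erase b).erase x, X s(y, p y) := by
  rw [h.forestPoly_eq K]
  · refine prod_congr ?_ fun _ _ => rfl
    ext y
    rw [mem_filter, mem_erase (b := x), and_comm, Ne, part_pairPartition]
    refine and_congr_left fun hy => not_congr ⟨?_, ?_⟩
    · rintro (h' | ⟨h', -⟩ | ⟨h1, h2⟩)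
      · exact absurd h'.symm (h.parent_ne (mem_erase.1 hy).1)
      · exact h'
      · exact h.edge_injOn (mem_erase.1 hy).1 hx (Sym2.eq_iff.2 (Or.inr ⟨h1, h2⟩))
    · rintro rfl
      exact Or.inr (Or.inl ⟨rfl, rfl⟩)
  · have hadj : (insideGraph (parentGraph p b) (pairPartition x (p x))).Adj x (p x) :=
      ⟨h.adj_parent hx, (part_pairPartition _ _ _ _).2 (Or.inr (Or.inl ⟨rfl, rfl⟩))⟩
    intro i j hij
    rcases (part_pairPartition _ _ _ _).1 hij with rfl | ⟨rfl, rfl⟩ | ⟨rfl, rfl⟩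
    · rfl
    · exact hadj.reachable
    · exact hadj.symm.reachable

lemma part_cut (h : IsRootedTree p b U) {x y : Fin m} (hx : x ≠ b) (hy : y ≠ b) :
    (cutPartition (U x)).part y = (cutPartition (U x)).part (p y) ↔ y ≠ x := by
  rw [part_cutPartition, h.cross x hx y hy]

/-- The removal of one edge of the tree leaves the two sides of its cut connected. -/
lemma reachable_cut (h : IsRootedTree p b U) {x : Fin m} (hx : x ≠ b) {i j : Fin m}
    (hij : (cutPartition (U x)).part i = (cutPartition (U x)).part j) :
    (insideGraph (parentGraph p b) (cutPartition (U x))).Reachable i j := by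
  set F := insideGraph (parentGraph p b) (cutPartition (U x)) with hF
  have hadj : ∀ y, y ≠ b → y ≠ x → F.Adj y (p y) := fun y hy hyx =>
    ⟨h.adj_parent hy, (h.part_cut hx hy).2 hyx⟩
  have key' : ∀ z y, (parentGraph p b).Walk z y → y = x →
      F.Reachable z x ∨ F.Reachable z (p x) := by
    intro z y w hyx
    induction w with
    | nil => exact Or.inl (hyx ▸ SimpleGraph.Reachable.refl _)
    | @cons u v _ huv _ ih =>
      rw [parentGraph, SimpleGraph.fromRel_adj] at huv
      rcases huv with ⟨-, ⟨hu, rfl⟩ | ⟨hv, rfl⟩⟩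
      · by_cases hux : u = x
        · exact Or.inl (hux ▸ SimpleGraph.Reachable.refl _)
        · have := (hadj u hu hux).reachable
          exact (ih hyx).imp this.trans this.trans
      · by_cases hvx : v = x
        · exact Or.inr (hvx ▸ SimpleGraph.Reachable.refl _)
        · have := (hadj v hv hvx).symm.reachable
          exact (ih hyx).imp this.trans this.trans
  have key : ∀ z, F.Reachable z x ∨ F.Reachable z (p x) := fun z =>
    (h.connected.preconnected z x).elim fun w => key' z x w rfl
  have hno : ¬ (cutPartition (U x)).part x = (cutPartition (U x)).part (p x) := fun hc =>
    (h.part_cut hx hx).1 hc rfl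
  rcases key i with hi | hi <;> rcases key j with hj | hj
  · exact hi.trans hj.symm
  · refine absurd ?_ hno
    rw [← part_eq_of_reachable_insideGraph hi, hij, part_eq_of_reachable_insideGraph hj]
  · refine absurd ?_ hno
    rw [← part_eq_of_reachable_insideGraph hj, ← hij, part_eq_of_reachable_insideGraph hi]
  · exact hi.trans hj.symm

lemma forestPoly_cut (K : Type*) [CommRing K] (h : IsRootedTree p b U) {x : Fin m}
    (hx : x ≠ b) :
    forestPoly K (parentGraph p b) (Function.Embedding.refl (Fin m)) (cutPartition (U x)) =
      X s(x, p x) := by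
  rw [h.forestPoly_eq K fun i j => h.reachable_cut hx]
  rw [show ((univ.erase b).filter fun y => (cutPartition (U x)).part y ≠
    (cutPartition (U x)).part (p y)) = {x} from ?_, prod_singleton]
  ext y
  rw [mem_filter, mem_singleton]
  constructor
  · rintro ⟨hy, hne⟩
    by_contra hyx
    exact hne ((h.part_cut hx (mem_erase.1 hy).1).2 hyx)
  · rintro rfl
    exact ⟨mem_erase.2 ⟨hx, mem_univ _⟩, fun hc => (h.part_cut hx hx).1 hc rfl⟩

lemma card_parts_cut (h : IsRootedTree p b U) {x : Fin m} (hx : x ≠ b) :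
    (cutPartition (U x)).parts.card = 2 := by
  have hc := h.cross x hx x hx
  by_cases h1 : x ∈ U x
  · exact card_parts_cutPartition h1 (v := p x) (by tauto)
  · exact card_parts_cutPartition (u := p x) (by tauto) h1

/-- Only the `A` partitions that join the ends of an edge of the tree have connected parts. -/
lemma eq_pair_of_forestPoly_ne_zero {K : Type*} [CommRing K] {k : ℕ} {p : Fin (k + 1) → Fin (k + 1)}
    {b : Fin (k + 1)} {U : Fin (k + 1) → Finset (Fin (k + 1))} (h : IsRootedTree p b U)
    {A : APartition k}
    (hA : forestPoly K (parentGraph p b) (Function.Embedding.refl (Fin (k + 1))) A.1 ≠ 0) :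
    ∃ x, x ≠ b ∧ A.1 = pairPartition x (p x) := by
  have hconn := not_not.1 (mt (forestPoly_eq_zero h.isAcyclic) hA)
  obtain ⟨u, v, huv, hAuv⟩ := exists_eq_pairPartition A.2
  have hu : A.1.part u = A.1.part v := by
    rw [hAuv, part_pairPartition]
    exact Or.inr (Or.inl ⟨rfl, rfl⟩)
  obtain ⟨w⟩ := hconn u v hu
  have : ∃ x, x ≠ b ∧ A.1.part x = A.1.part (p x) := by
    cases w with
    | nil => exact absurd rfl huv
    | @cons _ z _ hz _ =>
      obtain ⟨hadj, hz⟩ := hz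
      rw [parentGraph, SimpleGraph.fromRel_adj] at hadj
      rcases hadj with ⟨-, ⟨h1, rfl⟩ | ⟨h1, rfl⟩⟩
      · exact ⟨_, h1, hz⟩
      · exact ⟨_, h1, hz.symm⟩
  obtain ⟨x, hx, hxp⟩ := this
  refine ⟨x, hx, (eq_of_refines ?_ ?_).symm⟩
  · intro i j hij
    rcases (part_pairPartition _ _ _ _).1 hij with rfl | ⟨rfl, rfl⟩ | ⟨rfl, rfl⟩
    · rfl
    · exact hxp
    · exact hxp.symm
  · rw [card_parts_pairPartition (h.parent_ne hx).symm, A.2]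

/-- Only the `B` partitions given by the removal of an edge of the tree have connected parts. -/
lemma eq_cut_of_forestPoly_ne_zero {K : Type*} [CommRing K] {B : MarkedPartition m}
    (hB2 : B.parts.card = 2) (h : IsRootedTree p b U)
    (hB : forestPoly K (parentGraph p b) (Function.Embedding.refl (Fin m)) B ≠ 0) :
    ∃ x, x ≠ b ∧ B = cutPartition (U x) := by
  have hconn := not_not.1 (mt (forestPoly_eq_zero h.isAcyclic) hB)
  have : ∃ x, x ≠ b ∧ B.part x ≠ B.part (p x) := by
    by_contra! hall
    have hconst : ∀ i j, B.part i = B.part j := by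
      intro i j
      refine part_eq_of_reachable_insideGraph (G := parentGraph p b)
        ((h.connected.preconnected i j).mono fun x y hxy => ⟨hxy, ?_⟩)
      rw [parentGraph, SimpleGraph.fromRel_adj] at hxy
      rcases hxy with ⟨-, ⟨h1, rfl⟩ | ⟨h1, rfl⟩⟩
      · exact hall _ h1
      · exact (hall _ h1).symm
    obtain ⟨S, u, v, hu, hv, rfl⟩ := exists_eq_cutPartition hB2
    have := (part_cutPartition S u v).1 (hconst u v)
    exact hv (this.1 hu)
  obtain ⟨x, hx, hxp⟩ := this
  refine ⟨x, hx, eq_of_refines ?_ ?_⟩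
  · intro i j hij
    refine part_eq_of_reachable_insideGraph (G := parentGraph p b)
      (SimpleGraph.Reachable.mono (fun y z (hyz' : (insideGraph _ B).Adj y z) => ⟨hyz'.1, ?_⟩)
        (hconn i j hij))
    obtain ⟨hadj, hyz⟩ := hyz'
    rw [parentGraph, SimpleGraph.fromRel_adj] at hadj
    rcases hadj with ⟨-, ⟨h1, rfl⟩ | ⟨h1, rfl⟩⟩
    · exact (h.part_cut hx h1).2 fun hyx => hxp (hyx ▸ hyz)
    · exact ((h.part_cut hx h1).2 fun hyx => hxp (hyx ▸ hyz.symm)).symm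
  · rw [hB2, h.card_parts_cut hx]

end IsRootedTree

/-! ### Minors of the generic Laplacian -/

lemma part_root {m : ℕ} (P : MarkedPartition m) (i : Fin m) : P.part (root P i) = P.part i :=
  (part_eq_of_mem_part.1 (min'_mem _ _)).symm

lemma root_eq_iff {m : ℕ} {P : MarkedPartition m} {i j : Fin m} :
    root P i = root P j ↔ P.part i = P.part j := by
  constructor
  · intro h
    rw [← part_root P i, h, part_root]
  · intro h
    simp only [root, h]

lemma root_root {m : ℕ} (P : MarkedPartition m) (i : Fin m) : root P (root P i) = root P i :=
  root_eq_iff.2 (part_root P i)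

lemma mem_representativeForest {m : ℕ} {P : MarkedPartition m} {e : Sym2 (Fin m)} :
    e ∈ representativeForest P ↔ ∃ i, root P i ≠ i ∧ s(root P i, i) = e := by
  simp [representativeForest]

lemma representativeForest_pairPartition {m : ℕ} {u v : Fin m} (h : u ≠ v) :
    representativeForest (pairPartition u v) = {s(u, v)} := by
  have hsub : ∀ i, root (pairPartition u v) i ≠ i →
      s(root (pairPartition u v) i, i) = s(u, v) := by
    intro i hi
    have := (part_pairPartition u v _ _).1 (part_root (pairPartition u v) i)
    rw [Sym2.eq_iff]
    tauto
  have hroot : root (pairPartition u v) u = root (pairPartition u v) v :=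
    root_eq_iff.2 ((part_pairPartition u v u v).2 (Or.inr (Or.inl ⟨rfl, rfl⟩)))
  ext e
  rw [mem_representativeForest, mem_singleton]
  constructor
  · rintro ⟨i, hi, rfl⟩
    exact hsub i hi
  · rintro rfl
    by_cases hu : root (pairPartition u v) u = u
    · have hv : root (pairPartition u v) v ≠ v := by rw [← hroot, hu]; exact h
      exact ⟨v, hv, hsub v hv⟩
    · exact ⟨u, hu, hsub u hu⟩

lemma partitionCoeff_laplacian {m : ℕ} {u v : Fin m} (h : u ≠ v) (i j : Fin m) :
    partitionCoeff (pairPartition u v) (genericLaplacian m i j) =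
      if i = j then (if i = u ∨ i = v then 1 else 0)
      else (if s(i, j) = s(u, v) then -1 else 0) := by
  have hX : ∀ e : Sym2 (Fin m), coeff (Finsupp.single s(u, v) 1) (X e : MvPolynomial _ ℤ) =
      if e = s(u, v) then 1 else 0 := by
    intro e
    rw [coeff_X]
    simp only [Finsupp.single_left_inj one_ne_zero]
  rw [partitionCoeff, representativeForest_pairPartition h, sum_singleton, genericLaplacian,
    Matrix.of_apply]
  split_ifs with hij huv he
  · rw [coeff_sum]
    simp only [hX]
    rcases huv with rfl | rfl
    · rw [sum_eq_single_of_mem v (mem_erase.2 ⟨h.symm, mem_univ v⟩), if_pos rfl]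
      intro l hl hlv
      rw [if_neg]
      rw [Sym2.eq_iff]
      rintro (⟨-, h'⟩ | ⟨h', -⟩)
      · exact hlv h'
      · exact h h'
    · rw [sum_eq_single_of_mem u (mem_erase.2 ⟨h, mem_univ u⟩), if_pos Sym2.eq_swap]
      intro l hl hlv
      rw [if_neg]
      rw [Sym2.eq_iff]
      rintro (⟨h', -⟩ | ⟨-, h'⟩)
      · exact h h'.symm
      · exact hlv h'
  · rw [coeff_sum]
    refine sum_eq_zero fun l _ => ?_
    rw [hX, if_neg]
    rw [Sym2.eq_iff]
    tauto
  · rw [coeff_neg, hX, if_pos he]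
  · rw [coeff_neg, hX, if_neg he, neg_zero]

lemma minorDet_compl_singleton {R : Type*} [CommRing R] {N : ℕ} (M : Matrix (Fin N) (Fin N) R)
    (i j : Fin N) (h : (univ \ {i} : Finset (Fin N)).card = (univ \ {j}).card) :
    minorDet M (univ \ {i}) (univ \ {j}) h = M i j := by
  have hs : ∀ x y : Fin N, y ∈ (univ \ {x} : Finset (Fin N))ᶜ ↔ y = x := by
    intro x y
    rw [mem_compl, mem_sdiff, mem_singleton]
    simp
  have hcard : ((univ \ {i} : Finset (Fin N))ᶜ).card = 1 :=
    card_eq_one.2 ⟨i, by ext y; rw [hs, mem_singleton]⟩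
  have hi : ∀ x, ((univ \ {i} : Finset (Fin N))ᶜ).orderEmbOfFin rfl x = i := fun x =>
    (hs i _).1 (orderEmbOfFin_mem _ rfl x)
  have hj : ∀ h' x, ((univ \ {j} : Finset (Fin N))ᶜ).orderEmbOfFin
      (k := ((univ \ {i} : Finset (Fin N))ᶜ).card) h' x = j := fun h' x =>
    (hs j _).1 (orderEmbOfFin_mem _ h' x)
  rw [minorDet, Matrix.det_eq_elem_of_card_eq_one (by rw [Fintype.card_fin, hcard])
    ⟨0, by rw [hcard]; exact one_pos⟩, Matrix.submatrix_apply, hi, hj]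

lemma minorDet_singleton {R : Type*} [CommRing R] {N : ℕ} (M : Matrix (Fin N) (Fin N) R)
    (i j : Fin N) (h : ({i} : Finset (Fin N)).card = ({j} : Finset (Fin N)).card) :
    (-1) ^ ((i : ℕ) + (j : ℕ)) * minorDet M {i} {j} h = M.adjugate j i := by
  obtain ⟨n, rfl⟩ : ∃ n, N = n + 1 := ⟨N - 1, by have := i.pos; omega⟩
  rw [Matrix.adjugate_fin_succ_eq_det_submatrix, minorDet]
  congr 1
  have hcard : (({i} : Finset (Fin (n + 1)))ᶜ).card = n := by simp [card_compl]
  rw [← Matrix.det_submatrix_equiv_self (finCongr hcard)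
    (M.submatrix i.succAbove j.succAbove), Matrix.submatrix_submatrix]
  congr 2
  · ext x
    rw [orderEmbOfFin_compl_singleton_apply]
    rfl
  · ext x
    rw [orderEmbOfFin_compl_singleton_apply]
    rfl

/-- Setting the variables outside of `F` to zero does not change the coefficient of a monomial
in the variables of `F`. -/
lemma coeff_aeval_ite {σ R : Type*} [CommRing R] [DecidableEq σ] (F : Finset σ) {s : σ →₀ ℕ}
    (hs : s.support ⊆ F) (q : MvPolynomial σ R) :
    coeff s (aeval (fun e => if e ∈ F then (X e : MvPolynomial σ R) else 0) q) = coeff s q := by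
  induction q using MvPolynomial.induction_on' with
  | add p q hp hq => rw [map_add, coeff_add, coeff_add, hp, hq]
  | monomial t a =>
    rw [aeval_monomial]
    by_cases ht : t.support ⊆ F
    · rw [monomial_eq, algebraMap_eq]
      congr 2
      refine Finsupp.prod_congr fun e he => ?_
      rw [if_pos (ht he)]
    · obtain ⟨e, he, heF⟩ := not_subset.1 ht
      rw [Finsupp.prod, prod_eq_zero he, mul_zero, coeff_zero, coeff_monomial, if_neg]
      · rintro rfl
        exact ht hs
      · rw [if_neg heF, zero_pow (Finsupp.mem_support_iff.1 he)]

/-- The parent of a vertex in the tree with root `c` that arises from the representative forest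
of `P` when the root of each part without `c` is joined to `c`, and the part of `c` is rooted
at `c` instead of its least element. -/
def forestParent {m : ℕ} (P : MarkedPartition m) (c x : Fin m) : Fin m :=
  if root P x = x then c else root P x

lemma forestParent_ne {m : ℕ} {P : MarkedPartition m} {c x : Fin m} (hx : x ≠ c) :
    forestParent P c x ≠ x := by
  rw [forestParent]
  split_ifs with h
  · exact hx.symm
  · exact h

lemma forestParent_edge_injOn {m : ℕ} {P : MarkedPartition m} {c x y : Fin m} (hx : x ≠ c)
    (hy : y ≠ c) (h : s(x, forestParent P c x) = s(y, forestParent P c y)) : x = y := by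
  rcases Sym2.eq_iff.1 h with ⟨h1, -⟩ | ⟨h1, h2⟩
  · exact h1
  · rw [forestParent] at h2
    split_ifs at h2 with h3
    · exact absurd h2.symm hy
    · rw [forestParent, if_pos (by rw [← h2, root_root])] at h1
      exact absurd h1 hx

/-- Every edge of the representative forest joins a vertex to its parent. -/
lemma exists_forestParent_edge {k : ℕ} {P : MarkedPartition (k + 1)} (c : Fin (k + 1))
    {e : Sym2 (Fin (k + 1))} (he : e ∈ representativeForest P) :
    ∃ l, s(c.succAbove l, forestParent P c (c.succAbove l)) = e := by
  obtain ⟨x, hx, rfl⟩ := mem_representativeForest.1 he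
  by_cases hxc : x = c
  · subst hxc
    obtain ⟨l, hl⟩ := Fin.exists_succAbove_eq hx
    refine ⟨l, ?_⟩
    rw [hl, forestParent, if_pos (root_root P x)]
  · obtain ⟨l, rfl⟩ := Fin.exists_succAbove_eq hxc
    refine ⟨l, ?_⟩
    rw [forestParent, if_neg hx, Sym2.eq_swap]

lemma part_eq_of_mem_representativeForest {m : ℕ} {P : MarkedPartition m} {x y : Fin m}
    (h : s(x, y) ∈ representativeForest P) : P.part x = P.part y := by
  obtain ⟨z, -, hz⟩ := mem_representativeForest.1 h
  rcases Sym2.eq_iff.1 hz with ⟨rfl, rfl⟩ | ⟨rfl, rfl⟩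
  · exact part_root P _
  · exact (part_root P _).symm

/-- The weight of an edge after all the variables outside of the representative forest of `P` have
been set to zero. -/
noncomputable def forestWeight {m : ℕ} (P : MarkedPartition m) (e : Sym2 (Fin m)) :
    MvPolynomial (Sym2 (Fin m)) ℤ :=
  if e ∈ representativeForest P then X e else 0

/-- The incidence matrix of the tree of `forestParent P c`, without the column of the root `c`:
its row `l` belongs to the edge from the `l`-th vertex to its parent. -/
def forestIncidence {k : ℕ} (R : Type*) [CommRing R] (P : MarkedPartition (k + 1))
    (c : Fin (k + 1)) : Matrix (Fin k) (Fin k) R :=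
  Matrix.of fun l i => (if l = i then 1 else 0) -
    if forestParent P c (c.succAbove l) = c.succAbove i then 1 else 0

lemma forestWeight_eq_sum {k : ℕ} (P : MarkedPartition (k + 1)) (c i t : Fin (k + 1)) :
    forestWeight P s(i, t) = ∑ l : Fin k,
      if s(c.succAbove l, forestParent P c (c.succAbove l)) = s(i, t) then
        forestWeight P s(c.succAbove l, forestParent P c (c.succAbove l)) else 0 := by
  by_cases h : s(i, t) ∈ representativeForest P
  · obtain ⟨l, hl⟩ := exists_forestParent_edge c h
    rw [sum_eq_single l, if_pos hl, hl]
    · intro l' _ hne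
      rw [if_neg]
      intro hl'
      exact hne (Fin.succAbove_right_injective (forestParent_edge_injOn (Fin.succAbove_ne c l')
        (Fin.succAbove_ne c l) (hl'.trans hl.symm)))
    · exact fun hn => absurd (mem_univ l) hn
  · rw [forestWeight, if_neg h]
    refine (sum_eq_zero fun l _ => ?_).symm
    split_ifs with hl
    · rw [hl, forestWeight, if_neg h]
    · rfl

/-- The reduced Laplacian of the representative forest is `Nᵀ D N` for the incidence matrix `N`
of the tree and the diagonal matrix `D` of the weights. -/
lemma map_reducedLaplacian {k : ℕ} (P : MarkedPartition (k + 1)) (c : Fin (k + 1)) :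
    (aeval (forestWeight P)).toRingHom.mapMatrix (reducedLaplacian k c c) =
      (forestIncidence _ P c).transpose * Matrix.diagonal (fun l =>
        forestWeight P s(c.succAbove l, forestParent P c (c.succAbove l))) *
        forestIncidence _ P c := by
  ext1 i j
  rw [Matrix.mul_apply]
  simp only [Matrix.mul_diagonal, Matrix.transpose_apply, RingHom.mapMatrix_apply,
    Matrix.map_apply, reducedLaplacian, Matrix.submatrix_apply, genericLaplacian, Matrix.of_apply,
    forestIncidence]
  by_cases hij : i = j
  · subst hij
    simp only [if_true, AlgHom.toRingHom_eq_coe, RingHom.coe_coe, map_sum, aeval_X]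
    simp_rw [forestWeight_eq_sum P c (c.succAbove i)]
    rw [sum_comm]
    refine sum_congr rfl fun l _ => ?_
    have hne := forestParent_ne (P := P) (Fin.succAbove_ne c l)
    by_cases hl : l = i
    · subst hl
      rw [if_pos rfl, if_neg hne, sum_eq_single_of_mem (forestParent P c (c.succAbove l))
        (mem_erase.2 ⟨hne, mem_univ _⟩), if_pos rfl]
      · ring
      · intro t _ ht
        rw [if_neg]
        rw [Sym2.eq_iff]
        rintro (⟨-, h⟩ | ⟨-, h⟩)
        · exact ht h.symm
        · exact hne h
    · rw [if_neg hl]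
      have hl' : c.succAbove l ≠ c.succAbove i := fun h => hl (Fin.succAbove_right_injective h)
      by_cases hp : forestParent P c (c.succAbove l) = c.succAbove i
      · rw [if_pos hp, sum_eq_single_of_mem (c.succAbove l) (mem_erase.2 ⟨hl', mem_univ _⟩),
          if_pos (by rw [hp, Sym2.eq_swap])]
        · ring
        · intro t _ ht
          rw [if_neg]
          rw [Sym2.eq_iff]
          rintro (⟨h, -⟩ | ⟨h, -⟩)
          · exact hl' h
          · exact ht h.symm
      · rw [if_neg hp, sub_zero, zero_mul, zero_mul]
        refine sum_eq_zero fun t _ => if_neg ?_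
        rw [Sym2.eq_iff]
        rintro (⟨h, -⟩ | ⟨-, h⟩)
        · exact hl' h
        · exact hp h
  · have hij' : c.succAbove i ≠ c.succAbove j := fun h => hij (Fin.succAbove_right_injective h)
    rw [if_neg hij']
    simp only [AlgHom.toRingHom_eq_coe, RingHom.coe_coe, map_neg, aeval_X]
    rw [forestWeight_eq_sum P c, ← sum_neg_distrib]
    refine sum_congr rfl fun l _ => ?_
    have hne := forestParent_ne (P := P) (Fin.succAbove_ne c l)
    have hinj : ∀ x y : Fin k, c.succAbove x = c.succAbove y ↔ x = y := fun x y =>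
      Fin.succAbove_right_injective.eq_iff
    simp only [Sym2.eq_iff, hinj]
    by_cases h1 : l = i
    · subst h1
      simp only [if_neg hne, true_and, hij, false_and, or_false, if_true, if_false]
      split_ifs <;> ring
    · by_cases h2 : l = j
      · subst h2
        simp only [if_neg hne, h1, true_and, false_and, false_or, if_true, if_false]
        split_ifs <;> ring
      · simp only [h1, h2, false_and, or_false, if_false]
        by_cases h3 : forestParent P c (c.succAbove l) = c.succAbove i
        · rw [h3, if_neg hij']
          ring
        · rw [if_neg h3]
          ring

lemma det_forestIncidence {k : ℕ} (R : Type*) [CommRing R] (P : MarkedPartition (k + 1))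
    (c : Fin (k + 1)) : (forestIncidence R P c).det = 1 := by
  -- Ordered with the roots of the parts last, the matrix is unitriangular.
  let b : Fin k → ℕ := fun l => if root P (c.succAbove l) = c.succAbove l then 1 else 0
  have hb : ∀ l i, forestParent P c (c.succAbove l) = c.succAbove i → b l = 0 ∧ b i = 1 := by
    intro l i h
    rw [forestParent] at h
    split_ifs at h with h'
    · exact absurd h.symm (Fin.succAbove_ne c i)
    · exact ⟨if_neg h', if_pos (by rw [← h, root_root])⟩
  have htri : (forestIncidence R P c).BlockTriangular b := by
    intro l i hli
    rw [forestIncidence, Matrix.of_apply, if_neg, if_neg, sub_zero]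
    · intro h
      have := hb l i h
      omega
    · rintro rfl
      exact lt_irrefl _ hli
  rw [htri.det]
  refine prod_eq_one fun a _ => ?_
  rw [show (forestIncidence R P c).toSquareBlock b a = 1 from ?_, Matrix.det_one]
  ext ⟨l, hl⟩ ⟨i, hi⟩
  rw [Matrix.toSquareBlock_def, Matrix.of_apply, forestIncidence, Matrix.of_apply,
    Matrix.one_apply, if_neg (c := forestParent P c _ = _), sub_zero]
  · simp only [Subtype.mk.injEq]
  intro h
  have := hb l i h
  omega

/-- The cofactors of the reduced Laplacian of a representative forest with two trees. -/
lemma adjugate_map_reducedLaplacian {k : ℕ} {P : MarkedPartition (k + 1)} (hP : P.parts.card = 2)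
    (c : Fin (k + 1)) (i j : Fin k) :
    ((aeval (forestWeight P)).toRingHom.mapMatrix (reducedLaplacian k c c)).adjugate i j =
      if P.part (c.succAbove i) ≠ P.part c ∧ P.part (c.succAbove j) ≠ P.part c then
        ∏ e ∈ representativeForest P, X e else 0 := by
  obtain ⟨S, u, v, hu, hv, hPS⟩ := exists_eq_cutPartition hP
  have htwo : ∀ x y z, P.part x ≠ P.part z → P.part y ≠ P.part z → P.part x = P.part y := by
    intro x y z
    simp only [hPS, Ne, part_cutPartition]
    tauto
  obtain ⟨z, hz⟩ : ∃ z, P.part z ≠ P.part c := by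
    simp only [hPS, Ne, part_cutPartition]
    by_cases hc : c ∈ S
    · exact ⟨v, by tauto⟩
    · exact ⟨u, by tauto⟩
  have hroot : P.part (root P z) ≠ P.part c := by rwa [part_root]
  obtain ⟨i₂, hi₂⟩ : ∃ i₂, c.succAbove i₂ = root P z :=
    Fin.exists_succAbove_eq fun h => hroot (by rw [h])
  -- `i₂` is the root of the part without `c`; its edge to `c` is not in the forest.
  have huniq : ∀ l, root P (c.succAbove l) = c.succAbove l → P.part (c.succAbove l) ≠ P.part c →
      l = i₂ := by
    intro l hl hlc
    refine Fin.succAbove_right_injective (p := c) ?_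
    rw [hi₂, ← hl, root_eq_iff]
    exact htwo _ _ _ hlc hz
  set d : Fin k → MvPolynomial (Sym2 (Fin (k + 1))) ℤ := fun l =>
    forestWeight P s(c.succAbove l, forestParent P c (c.succAbove l)) with hd
  have hd₂ : d i₂ = 0 := by
    rw [hd]
    simp only
    rw [forestWeight, if_neg]
    intro h
    have := part_eq_of_mem_representativeForest h
    rw [hi₂, forestParent, if_pos (root_root P z)] at this
    exact hroot this
  have hprod : ∏ l ∈ univ.erase i₂, d l = ∏ e ∈ representativeForest P, X e := by
    have hmem : ∀ l, l ≠ i₂ → s(c.succAbove l, forestParent P c (c.succAbove l)) ∈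
        representativeForest P := by
      intro l hl
      by_cases hr : root P (c.succAbove l) = c.succAbove l
      · have hlc : P.part (c.succAbove l) = P.part c := by
          by_contra hne
          exact hl (huniq l hr hne)
        have hrc : root P c = c.succAbove l := by rw [← root_eq_iff.2 hlc, hr]
        rw [forestParent, if_pos hr]
        exact mem_representativeForest.2 ⟨c, by rw [hrc]; exact Fin.succAbove_ne c l, by rw [hrc]⟩
      · rw [forestParent, if_neg hr, Sym2.eq_swap]
        exact mem_representativeForest.2 ⟨_, hr, rfl⟩
    refine prod_bij (fun l _ => s(c.succAbove l, forestParent P c (c.succAbove l))) ?_ ?_ ?_ ?_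
    · exact fun l hl => hmem l (mem_erase.1 hl).1
    · intro l _ l' _ h
      exact Fin.succAbove_right_injective
        (forestParent_edge_injOn (Fin.succAbove_ne c l) (Fin.succAbove_ne c l') h)
    · intro e he
      obtain ⟨l, rfl⟩ := exists_forestParent_edge c he
      refine ⟨l, mem_erase.2 ⟨?_, mem_univ l⟩, rfl⟩
      rintro rfl
      rw [hd] at hd₂
      simp only [forestWeight, if_pos he] at hd₂
      exact X_ne_zero _ hd₂
    · intro l hl
      rw [hd]
      simp only
      rw [forestWeight, if_pos (hmem l (mem_erase.1 hl).1)]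
  set N := forestIncidence (MvPolynomial (Sym2 (Fin (k + 1))) ℤ) P c with hN
  set χ : Fin (k + 1) → MvPolynomial (Sym2 (Fin (k + 1))) ℤ := fun x =>
    if P.part x ≠ P.part c then 1 else 0 with hχ
  -- `N` maps the indicator vector of the part without `c` to a unit vector.
  have hker : N.mulVec (fun l => χ (c.succAbove l)) = Pi.single i₂ 1 := by
    ext1 l
    have hχc : χ c = 0 := by simp [hχ]
    have h1 : ∀ x, (∑ i, (if x = c.succAbove i then 1 else 0) * χ (c.succAbove i)) = χ x := by
      intro x
      have := Fin.sum_univ_succAbove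
        (fun y => (if x = y then (1 : MvPolynomial (Sym2 (Fin (k + 1))) ℤ) else 0) * χ y) c
      rw [hχc, mul_zero, zero_add] at this
      rw [← this]
      simp
    have h2 : (N.mulVec fun l => χ (c.succAbove l)) l =
        χ (c.succAbove l) - χ (forestParent P c (c.succAbove l)) := by
      rw [Matrix.mulVec, dotProduct, ← h1 (c.succAbove l), ← h1 (forestParent P c _),
        ← sum_sub_distrib]
      refine sum_congr rfl fun i _ => ?_
      rw [hN, forestIncidence, Matrix.of_apply, sub_mul]
      simp only [Fin.succAbove_right_injective.eq_iff]
    rw [h2]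
    by_cases hl : l = i₂
    · subst hl
      rw [Pi.single_eq_same, hi₂, forestParent, if_pos (root_root P z), hχc, sub_zero]
      exact if_pos hroot
    · rw [Pi.single_eq_of_ne hl, forestParent]
      split_ifs with hr
      · rw [hχc, sub_zero]
        exact if_neg fun h => hl (huniq l hr h)
      · simp only [hχ, part_root, sub_self]
  have hadj : ∀ l, N.adjugate l i₂ = χ (c.succAbove l) := by
    intro l
    have h1 : N.adjugate.mulVec (N.mulVec fun l => χ (c.succAbove l)) =
        fun l => χ (c.succAbove l) := by
      rw [Matrix.mulVec_mulVec, Matrix.adjugate_mul, hN, det_forestIncidence, one_smul,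
        Matrix.one_mulVec]
    rw [hker, Matrix.mulVec_single_one] at h1
    exact congrFun h1 l
  rw [map_reducedLaplacian, Matrix.adjugate_mul_distrib, Matrix.adjugate_mul_distrib,
    Matrix.adjugate_diagonal, ← Matrix.adjugate_transpose, ← hN, ← Matrix.mul_assoc,
    Matrix.mul_apply]
  simp only [Matrix.mul_diagonal, Matrix.transpose_apply]
  rw [sum_eq_single i₂, hadj, hadj, hprod]
  · by_cases h1 : P.part (c.succAbove i) = P.part c
    · rw [show χ (c.succAbove i) = 0 from if_neg (not_not.2 h1), zero_mul, zero_mul,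
        if_neg fun h => h.1 h1]
    · rw [show χ (c.succAbove i) = 1 from if_pos h1, one_mul]
      by_cases h2 : P.part (c.succAbove j) = P.part c
      · rw [show χ (c.succAbove j) = 0 from if_neg (not_not.2 h2), mul_zero,
          if_neg fun h => h.2 h2]
      · rw [show χ (c.succAbove j) = 1 from if_pos h2, mul_one, if_pos ⟨h1, h2⟩]
  · intro l _ hl
    rw [prod_eq_zero (mem_erase.2 ⟨hl.symm, mem_univ i₂⟩) hd₂, mul_zero, zero_mul]
  · exact fun h => absurd (mem_univ i₂) h

lemma partitionCoeff_adjugate {k : ℕ} {P : MarkedPartition (k + 1)} (hP : P.parts.card = 2)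
    (c : Fin (k + 1)) (i j : Fin k) :
    partitionCoeff P ((reducedLaplacian k c c).adjugate i j) =
      if P.part (c.succAbove i) ≠ P.part c ∧ P.part (c.succAbove j) ≠ P.part c then 1 else 0 := by
  have hsupp : (∑ e ∈ representativeForest P, Finsupp.single e 1 :
      Sym2 (Fin (k + 1)) →₀ ℕ).support ⊆ representativeForest P := by
    intro e he
    rw [Finsupp.mem_support_iff, Finsupp.finsetSum_apply] at he
    obtain ⟨e', he', hne⟩ := exists_ne_zero_of_sum_ne_zero he
    rw [Finsupp.single_apply] at hne
    by_cases h : e' = e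
    · exact h ▸ he'
    · exact absurd (if_neg h) hne
  have hmap := congrFun (congrFun (RingHom.map_adjugate (aeval (forestWeight P)).toRingHom
    (reducedLaplacian k c c)) i) j
  rw [adjugate_map_reducedLaplacian hP] at hmap
  rw [partitionCoeff, ← coeff_aeval_ite (representativeForest P) hsupp]
  change coeff _ ((aeval (forestWeight P)) ((reducedLaplacian k c c).adjugate i j)) = _
  rw [show (aeval (forestWeight P)) ((reducedLaplacian k c c).adjugate i j) = _ from hmap]
  split_ifs
  · have : (∏ e ∈ representativeForest P, X e : MvPolynomial (Sym2 (Fin (k + 1))) ℤ) =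
        monomial (∑ e ∈ representativeForest P, Finsupp.single e 1) 1 := by
      rw [monomial_sum_one]
      rfl
    rw [this, coeff_monomial, if_pos rfl]
  · exact coeff_zero _

/-! ### The column expansion identities for principal minors -/

lemma partitionCoeff_neg_one_pow_mul {m : ℕ} (P : MarkedPartition m) (n : ℕ)
    (q : MvPolynomial (Sym2 (Fin m)) ℤ) :
    partitionCoeff P ((-1) ^ n * q) = (-1) ^ n * partitionCoeff P q := by
  rw [partitionCoeff, partitionCoeff, ← coeff_C_mul]
  simp

/-- `L_{c,c}(j)` consists of the monomials `AB` for which `A` joins the vertex `d` of the `j`-th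
column to some vertex that `B` separates from `d` and leaves together with `c`. -/
lemma columnL_self {k : ℕ} (c : Fin (k + 1)) (j : Fin k) {A : APartition k} {B : BPartition k}
    {u v : Fin (k + 1)} (huv : u ≠ v) (hA : A.1 = pairPartition u v) {S : Finset (Fin (k + 1))}
    (hB : B.1 = cutPartition S) :
    columnL k c c j A B =
      if c.succAbove j = u then (if (c ∈ S ↔ v ∈ S) ∧ ¬ (u ∈ S ↔ v ∈ S) then 1 else 0)
      else if c.succAbove j = v then (if (c ∈ S ↔ u ∈ S) ∧ ¬ (u ∈ S ↔ v ∈ S) then 1 else 0)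
      else 0 := by
  set d := c.succAbove j with hd
  let g : Fin (k + 1) → ℤ := fun x =>
    (if ¬ (d ∈ S ↔ c ∈ S) ∧ ¬ (x ∈ S ↔ c ∈ S) then 1 else 0) *
      if x = d then (if x = u ∨ x = v then 1 else 0) else (if s(x, d) = s(u, v) then -1 else 0)
  have h1 : columnL k c c j A B = ∑ x, g x := by
    rw [columnL, ← two_mul, pow_mul, neg_one_sq, one_pow, one_mul, Fin.sum_univ_succAbove g c,
      show g c = 0 by simp [g], zero_add]
    refine sum_congr rfl fun i _ => ?_
    rw [← partitionCoeff_neg_one_pow_mul, minorDet_singleton, minorDet_compl_singleton,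
      partitionCoeff_adjugate B.2, hA, reducedLaplacian, Matrix.submatrix_apply,
      partitionCoeff_laplacian huv, hB]
    simp only [Ne, part_cutPartition, g, hd]
  rw [h1]
  have h2 : ∀ x, x ≠ u → x ≠ v → g x = 0 := by
    intro x hxu hxv
    simp only [g]
    rw [if_neg (c := x = u ∨ x = v) (by tauto), if_neg (c := s(x, d) = s(u, v)), ite_self, mul_zero]
    rw [Sym2.eq_iff]
    tauto
  have h3 : ∑ x, g x = g u + g v := by
    rw [← sum_pair huv]
    refine (sum_subset (subset_univ _) fun x _ hx => ?_).symm
    rw [mem_insert, mem_singleton, not_or] at hx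
    exact h2 x hx.1 hx.2
  rw [h3]
  simp only [g, Sym2.eq_iff]
  by_cases hdu : d = u
  · rw [if_pos hdu, hdu]
    simp only [huv, huv.symm, if_true, if_false, true_or, and_true, or_true]
    by_cases hu : u ∈ S <;> by_cases hv : v ∈ S <;> by_cases hc : c ∈ S <;> simp [hu, hv, hc]
  · rw [if_neg hdu]
    by_cases hdv : d = v
    · rw [if_pos hdv, hdv]
      simp only [huv, huv.symm, if_true, if_false, and_true, or_true]
      by_cases hu : u ∈ S <;> by_cases hv : v ∈ S <;> by_cases hc : c ∈ S <;> simp [hu, hv, hc]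
    · rw [if_neg hdv]
      simp [hdu, hdv, Ne.symm hdu, Ne.symm hdv]

/-! ### The relations that come from trees -/

/-- The coefficients `α`, extended by zero to all pairs of partitions. -/
noncomputable def extendCoeff {K : Type*} [Zero K] {k : ℕ} (α : APartition k → BPartition k → K)
    (P Q : MarkedPartition (k + 1)) : K :=
  if hP : P.parts.card = k then if hQ : Q.parts.card = 2 then α ⟨P, hP⟩ ⟨Q, hQ⟩ else 0 else 0

lemma extendCoeff_coe {K : Type*} [Zero K] {k : ℕ} (α : APartition k → BPartition k → K)
    (A : APartition k) (B : BPartition k) : extendCoeff α A.1 B.1 = α A B := by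
  rw [extendCoeff, dif_pos A.2, dif_pos B.2]

/-- The quadratic identity with coefficients `η` and `α` holds on the graph `G`, all of whose
vertices are marked. -/
def QuadraticIdentity {K : Type*} [CommRing K] {k : ℕ} (η : K)
    (α : APartition k → BPartition k → K) (G : SimpleGraph (Fin (k + 1))) : Prop :=
  C η * (forestPoly K G (Function.Embedding.refl _) ⊤ *
      forestPoly K G (Function.Embedding.refl _) ⊥) =
    ∑ A : APartition k, ∑ B : BPartition k, C (α A B) *
      (forestPoly K G (Function.Embedding.refl _) A.1 *
        forestPoly K G (Function.Embedding.refl _) B.1)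

namespace IsRootedTree

variable {K : Type*} [CommRing K] {k : ℕ} {η : K} {α : APartition k → BPartition k → K}
  {p : Fin (k + 1) → Fin (k + 1)} {b : Fin (k + 1)} {U : Fin (k + 1) → Finset (Fin (k + 1))}

/-- On a tree only the partitions that come from its edges contribute. -/
lemma quadraticIdentity_eq (h : IsRootedTree p b U)
    (hα : QuadraticIdentity η α (parentGraph p b)) :
    C η * ∏ x ∈ univ.erase b, (X s(x, p x) : MvPolynomial (Sym2 (Fin (k + 1))) K) =
      ∑ x : {x // x ≠ b}, ∑ y : {x // x ≠ b},
        C (extendCoeff α (pairPartition x.1 (p x)) (cutPartition (U y))) *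
          ((∏ z ∈ (univ.erase b).erase x.1, X s(z, p z)) * X s(y.1, p y)) := by
  rw [QuadraticIdentity, h.forestPoly_top K, h.forestPoly_bot K, one_mul] at hα
  rw [hα]
  symm
  let eA : {x // x ≠ b} → APartition k := fun x =>
    ⟨pairPartition x.1 (p x), card_parts_pairPartition (h.parent_ne x.2).symm⟩
  let eB : {x // x ≠ b} → BPartition k := fun x => ⟨cutPartition (U x), h.card_parts_cut x.2⟩
  have hA : Function.Injective eA := by
    intro x y hxy
    have h1 : pairPartition x.1 (p x) = pairPartition y.1 (p y) := congrArg Subtype.val hxy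
    have h2 := (part_pairPartition x.1 (p x) x.1 (p x)).2 (Or.inr (Or.inl ⟨rfl, rfl⟩))
    rw [h1, part_pairPartition] at h2
    refine Subtype.ext (h.edge_injOn x.2 y.2 (Sym2.eq_iff.2 (h2.resolve_left ?_)))
    exact (h.parent_ne x.2).symm
  have hB : Function.Injective eB := by
    intro x y hxy
    have h1 : cutPartition (U x) = cutPartition (U y) := congrArg Subtype.val hxy
    by_contra hne
    have h2 := (h.part_cut x.2 y.2).2 fun h' => hne (Subtype.ext h'.symm)
    rw [h1] at h2
    exact (h.part_cut y.2 y.2).1 h2 rfl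
  refine Fintype.sum_of_injective eA hA _ _ ?_ ?_
  · intro A hA'
    refine sum_eq_zero fun B _ => ?_
    by_cases h0 : forestPoly K (parentGraph p b) (Function.Embedding.refl _) A.1 = 0
    · rw [h0, zero_mul, mul_zero]
    · obtain ⟨x, hx, hAx⟩ := h.eq_pair_of_forestPoly_ne_zero h0
      exact absurd ⟨⟨x, hx⟩, Subtype.ext hAx.symm⟩ hA'
  · intro x
    refine Fintype.sum_of_injective eB hB _ _ ?_ ?_
    · intro B hB'
      by_cases h0 : forestPoly K (parentGraph p b) (Function.Embedding.refl _) B.1 = 0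
      · rw [h0, mul_zero, mul_zero]
      · obtain ⟨y, hy, hBy⟩ := eq_cut_of_forestPoly_ne_zero B.2 h h0
        exact absurd ⟨⟨y, hy⟩, Subtype.ext hBy.symm⟩ hB'
    · intro y
      rw [← extendCoeff_coe α, h.forestPoly_pair K x.2, h.forestPoly_cut K y.2]

/-- Comparison of the coefficients of a monomial `m`. -/
lemma quadraticIdentity_coeff (h : IsRootedTree p b U)
    (hα : QuadraticIdentity η α (parentGraph p b)) (m : Sym2 (Fin (k + 1)) →₀ ℕ) :
    (if ∑ z ∈ univ.erase b, Finsupp.single s(z, p z) 1 = m then η else 0) =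
      ∑ x : {x // x ≠ b}, ∑ y : {x // x ≠ b},
        if ∑ z ∈ (univ.erase b).erase x.1, Finsupp.single s(z, p z) 1 +
            Finsupp.single s(y.1, p y) 1 = m then
          extendCoeff α (pairPartition x.1 (p x)) (cutPartition (U y)) else 0 := by
  have hprod : ∀ s : Finset (Fin (k + 1)), (∏ z ∈ s, X s(z, p z) :
      MvPolynomial (Sym2 (Fin (k + 1))) K) =
      monomial (∑ z ∈ s, Finsupp.single s(z, p z) 1) 1 := by
    intro s
    rw [monomial_sum_one]
    rfl
  have := congrArg (coeff m) (h.quadraticIdentity_eq hα)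
  rw [hprod, coeff_C_mul, coeff_monomial, mul_ite, mul_one, mul_zero] at this
  rw [this, coeff_sum]
  refine sum_congr rfl fun x _ => ?_
  rw [coeff_sum]
  refine sum_congr rfl fun y _ => ?_
  rw [hprod, X, monomial_mul, mul_one, coeff_C_mul, coeff_monomial, mul_ite, mul_one, mul_zero]

lemma sum_erase_add_single (x : {x // x ≠ b}) :
    ∑ z ∈ (univ.erase b).erase x.1, Finsupp.single s(z, p z) 1 + Finsupp.single s(x.1, p x) 1 =
      (∑ z ∈ univ.erase b, Finsupp.single s(z, p z) 1 : Sym2 (Fin (k + 1)) →₀ ℕ) :=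
  sum_erase_add _ _ (mem_erase.2 ⟨x.2, mem_univ x.1⟩)

/-- The coefficients of the edges of a tree, each paired with the cut of the same edge, add up
to `η`. -/
lemma sum_extendCoeff (h : IsRootedTree p b U) (hα : QuadraticIdentity η α (parentGraph p b)) :
    ∑ x ∈ univ.erase b, extendCoeff α (pairPartition x (p x)) (cutPartition (U x)) = η := by
  have h1 := h.quadraticIdentity_coeff hα (∑ z ∈ univ.erase b, Finsupp.single s(z, p z) 1)
  rw [if_pos rfl] at h1
  rw [h1, sum_subtype (univ.erase b) (p := fun x => x ≠ b) (by simp)]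
  refine sum_congr rfl fun x _ => ?_
  rw [Fintype.sum_eq_single x, if_pos (sum_erase_add_single x)]
  intro y hy
  rw [if_neg]
  rw [← sum_erase_add_single x]
  intro h2
  have h3 := (Finsupp.single_left_inj one_ne_zero).1 (add_left_cancel h2)
  exact hy (Subtype.ext (h.edge_injOn y.2 x.2 h3))

/-- The coefficient of an edge of a tree, paired with the cut of another edge, is zero. -/
lemma extendCoeff_eq_zero (h : IsRootedTree p b U)
    (hα : QuadraticIdentity η α (parentGraph p b)) {x y : Fin (k + 1)} (hx : x ≠ b) (hy : y ≠ b)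
    (hxy : x ≠ y) : extendCoeff α (pairPartition x (p x)) (cutPartition (U y)) = 0 := by
  have hsum : ∀ x' y' : {x // x ≠ b},
      ∑ z ∈ (univ.erase b).erase x'.1, Finsupp.single s(z, p z) 1 +
        Finsupp.single s(y'.1, p y') 1 =
      (∑ z ∈ (univ.erase b).erase x, Finsupp.single s(z, p z) 1 +
        Finsupp.single s(y, p y) 1 : Sym2 (Fin (k + 1)) →₀ ℕ) → x'.1 = x ∧ y'.1 = y := by
    intro x' y' he
    have h1 := sum_erase_add_single (p := p) x'
    have h2 := sum_erase_add_single (p := p) (⟨x, hx⟩ : {x // x ≠ b})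
    -- Both sides are the sum over all the edges, with one edge removed and one added.
    have h3 : (Finsupp.single s(y'.1, p y') 1 + Finsupp.single s(x, p x) 1 :
        Sym2 (Fin (k + 1)) →₀ ℕ) =
        Finsupp.single s(y, p y) 1 + Finsupp.single s(x'.1, p x') 1 := by
      ext e
      have e0 := DFunLike.congr_fun he e
      have e1 := DFunLike.congr_fun h1 e
      have e2 := DFunLike.congr_fun h2 e
      simp only [Finsupp.add_apply] at e0 e1 e2 ⊢
      omega
    have h4 := DFunLike.congr_fun h3 s(y, p y)
    have hne : s(x, p x) ≠ s(y, p y) := fun h' => hxy (h.edge_injOn hx hy h')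
    have hy' : y'.1 = y := by
      by_contra hny
      have hne' : s(y'.1, p y') ≠ s(y, p y) := fun h' => hny (h.edge_injOn y'.2 hy h')
      rw [Finsupp.add_apply, Finsupp.add_apply, Finsupp.single_eq_same,
        Finsupp.single_eq_of_ne hne'.symm, Finsupp.single_eq_of_ne hne.symm] at h4
      omega
    rw [hy'] at h3
    have h5 := (Finsupp.single_left_inj one_ne_zero).1 (add_left_cancel h3)
    exact ⟨(h.edge_injOn hx x'.2 h5).symm, hy'⟩
  have h1 := h.quadraticIdentity_coeff hα
    (∑ z ∈ (univ.erase b).erase x, Finsupp.single s(z, p z) 1 + Finsupp.single s(y, p y) 1)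
  rw [if_neg, Fintype.sum_eq_single ⟨x, hx⟩, Fintype.sum_eq_single ⟨y, hy⟩, if_pos rfl] at h1
  · exact h1.symm
  · intro y' hy'
    exact if_neg fun he => hy' (Subtype.ext (hsum _ _ he).2)
  · intro x' hx'
    exact sum_eq_zero fun y' _ => if_neg fun he => hx' (Subtype.ext (hsum _ _ he).1)
  · rw [← sum_erase_add_single ⟨y, hy⟩]
    exact fun he => hxy (hsum ⟨y, hy⟩ ⟨y, hy⟩ he).1.symm

end IsRootedTree

/-! ### Double stars -/

/-- The parent function of the double star in which `a` is joined to `b`, the other vertices of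
`S` are joined to `a`, and all the others are joined to `b`. -/
def doubleStarParent {m : ℕ} (a b : Fin m) (S : Finset (Fin m)) (x : Fin m) : Fin m :=
  if x ∈ S ∧ x ≠ a then a else b

/-- The cuts of the edges of the double star. -/
def doubleStarCut {m : ℕ} (a : Fin m) (S : Finset (Fin m)) (x : Fin m) : Finset (Fin m) :=
  if x = a then S else {x}

lemma isRootedTree_doubleStar {m : ℕ} {a b : Fin m} {S : Finset (Fin m)} (ha : a ∈ S)
    (hb : b ∉ S) : IsRootedTree (doubleStarParent a b S) b (doubleStarCut a S) := by
  have hab : a ≠ b := fun h => hb (h ▸ ha)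
  constructor
  · have hadj : ∀ x, x ≠ b → (parentGraph (doubleStarParent a b S) b).Adj
        (doubleStarParent a b S x) x := by
      intro x hx
      rw [parentGraph, SimpleGraph.fromRel_adj]
      refine ⟨?_, Or.inr ⟨hx, rfl⟩⟩
      rw [doubleStarParent]
      split_ifs with h
      · exact h.2.symm
      · exact hx.symm
    have hra : (parentGraph (doubleStarParent a b S) b).Reachable b a := by
      have := hadj a hab
      rw [doubleStarParent, if_neg (by tauto)] at this
      exact this.reachable
    refine SimpleGraph.connected_iff_exists_forall_reachable _ |>.2 ⟨b, fun x => ?_⟩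
    by_cases hx : x = b
    · rw [hx]
    · have := hadj x hx
      rw [doubleStarParent] at this
      split_ifs at this with h
      · exact hra.trans this.reachable
      · exact this.reachable
  · intro x hx y hy
    simp only [doubleStarParent, doubleStarCut]
    by_cases hxa : x = a
    · subst hxa
      by_cases hyx : y = x
      · subst hyx
        simp [ha, hb]
      · by_cases hyS : y ∈ S <;> simp [hyx, hyS, ha, hb]
    · rw [if_neg hxa]
      simp only [mem_singleton]
      split_ifs with h
      · simp [Ne.symm hxa]
      · simp [Ne.symm hx]

section

variable {K : Type*} [CommRing K] {k : ℕ} {η : K} {α : APartition k → BPartition k → K}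

/-- A pair of vertices that the cut does not separate has coefficient zero. -/
lemma extendCoeff_eq_zero_of_mem (hα : ∀ G, QuadraticIdentity η α G) {S : Finset (Fin (k + 1))}
    {u v w : Fin (k + 1)} (hu : u ∈ S) (hv : v ∈ S) (hw : w ∉ S) (huv : u ≠ v) :
    extendCoeff α (pairPartition u v) (cutPartition S) = 0 := by
  have := (isRootedTree_doubleStar hu hw).extendCoeff_eq_zero (hα _) (x := v) (y := u)
    (fun h => hw (h ▸ hv)) (fun h => hw (h ▸ hu)) huv.symm
  rwa [doubleStarParent, if_pos ⟨hv, huv.symm⟩, doubleStarCut, if_pos rfl,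
    pairPartition_comm] at this

/-- The coefficient of the pair `x`, `y` together with the cut that isolates `x`. -/
noncomputable def leafCoeff (α : APartition k → BPartition k → K) (x y : Fin (k + 1)) : K :=
  if x = y then 0 else extendCoeff α (pairPartition x y) (cutPartition {x})

lemma extendCoeff_add_sum_leafCoeff (hα : ∀ G, QuadraticIdentity η α G)
    {S : Finset (Fin (k + 1))} {a b : Fin (k + 1)} (ha : a ∈ S) (hb : b ∉ S) :
    extendCoeff α (pairPartition a b) (cutPartition S) + ∑ x ∈ S, leafCoeff α x a +
      ∑ x ∈ Sᶜ, leafCoeff α x b = η := by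
  have hab : a ≠ b := fun h => hb (h ▸ ha)
  rw [← (isRootedTree_doubleStar ha hb).sum_extendCoeff (hα _),
    ← add_sum_erase (univ.erase b) _ (mem_erase.2 ⟨hab, mem_univ a⟩), add_assoc]
  congr 1
  · rw [doubleStarParent, if_neg (by tauto), doubleStarCut, if_pos rfl]
  · have hsplit : (univ.erase b).erase a = S.erase a ∪ Sᶜ.erase b := by
      ext x
      simp only [mem_erase, mem_univ, and_true, mem_union, mem_compl]
      by_cases hx : x ∈ S
      · have : x ≠ b := fun h => hb (h ▸ hx)
        tauto
      · have : x ≠ a := fun h => hx (h ▸ ha)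
        tauto
    have hdisj : Disjoint (S.erase a) (Sᶜ.erase b) :=
      disjoint_compl_right.mono (erase_subset _ _) (erase_subset _ _)
    rw [hsplit, sum_union hdisj]
    congr 1
    · rw [← add_sum_erase S _ ha, leafCoeff, if_pos rfl, zero_add]
      refine sum_congr rfl fun x hx => ?_
      have hxa := (mem_erase.1 hx).1
      rw [leafCoeff, if_neg hxa, doubleStarParent, if_pos ⟨(mem_erase.1 hx).2, hxa⟩,
        doubleStarCut, if_neg hxa]
    · rw [← add_sum_erase Sᶜ _ (mem_compl.2 hb), leafCoeff, if_pos rfl, zero_add]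
      refine sum_congr rfl fun x hx => ?_
      have hxb := (mem_erase.1 hx).1
      have hxS := mem_compl.1 (mem_erase.1 hx).2
      rw [leafCoeff, if_neg hxb, doubleStarParent, if_neg (by tauto), doubleStarCut,
        if_neg fun h : x = a => hxS (h ▸ ha)]

lemma sum_leafCoeff (hk : 1 ≤ k) (hα : ∀ G, QuadraticIdentity η α G) (b : Fin (k + 1)) :
    ∑ x, leafCoeff α x b = η := by
  obtain ⟨a, hab⟩ : ∃ a, a ≠ b := by
    have : Nontrivial (Fin (k + 1)) := Fin.nontrivial_iff_two_le.2 (by omega)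
    exact exists_ne b
  have h := extendCoeff_add_sum_leafCoeff hα (mem_singleton_self a)
    (fun h => hab (mem_singleton.1 h).symm : b ∉ ({a} : Finset _))
  rw [sum_singleton, leafCoeff, if_pos rfl, add_zero] at h
  rw [← h, ← sum_add_sum_compl {a}, sum_singleton, leafCoeff, if_neg hab]

/-- The coefficients `leafCoeff` determine all the others. -/
lemma extendCoeff_eq (hk : 1 ≤ k) (hα : ∀ G, QuadraticIdentity η α G)
    {S : Finset (Fin (k + 1))} {a b : Fin (k + 1)} (ha : a ∈ S) (hb : b ∉ S) :
    extendCoeff α (pairPartition a b) (cutPartition S) =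
      ∑ x ∈ S, leafCoeff α x b + ∑ x ∈ Sᶜ, leafCoeff α x a - η := by
  have h1 := extendCoeff_add_sum_leafCoeff hα ha hb
  have h2 := sum_leafCoeff hk hα a
  have h3 := sum_leafCoeff hk hα b
  rw [← sum_add_sum_compl S] at h2 h3
  linear_combination h1 - h2 - h3

end

end SpanningForest

/-! ### Solving for the linear combination -/

open SpanningForest Finset in
theorem theorem3p6 (K : Type*) [Field K] [CharZero K] (k : ℕ) (hk : 2 ≤ k)
    (η : K) (α : SpanningForest.APartition k → SpanningForest.BPartition k → K)
    (h : ∀ (n : ℕ) (G : SimpleGraph (Fin n)) (v : Fin (k + 1) ↪ Fin n),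
      MvPolynomial.C η *
          (SpanningForest.forestPoly K G v ⊤ * SpanningForest.forestPoly K G v ⊥) =
        ∑ A : SpanningForest.APartition k, ∑ B : SpanningForest.BPartition k,
          MvPolynomial.C (α A B) *
            (SpanningForest.forestPoly K G v A.1 * SpanningForest.forestPoly K G v B.1)) :
    ∃ ε : Fin (k + 1) → Fin (k + 1) → Fin k → K,
      η = ∑ r, ∑ c, ∑ j, ε r c j ∧
      ∀ (A : SpanningForest.APartition k) (B : SpanningForest.BPartition k),
        α A B = ∑ r, ∑ c, ∑ j, ε r c j * (SpanningForest.columnL k r c j A B : K) := by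
  have hα : ∀ G, QuadraticIdentity η α G := fun G => h (k + 1) G (Function.Embedding.refl _)
  have hm : ((k : K) + 1) ≠ 0 := by exact_mod_cast Nat.succ_ne_zero k
  have hdiag : ∀ F : Fin (k + 1) → Fin (k + 1) → K,
      ∑ r, ∑ c, ∑ j : Fin k, (if r = c then F c (c.succAbove j) else 0) =
        ∑ c, ∑ j : Fin k, F c (c.succAbove j) := by
    intro F
    refine sum_congr rfl fun r _ => ?_
    rw [sum_eq_single r]
    · simp
    · intro c _ hc
      exact sum_eq_zero fun j _ => if_neg hc.symm
    · exact fun hr => absurd (mem_univ r) hr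
  have hleaf : ∀ x, leafCoeff α x x = 0 := fun x => if_pos rfl
  -- `extendCoeff_eq` is off by `η`, which is spread evenly over the `k + 1` vertices `c` that
  -- contribute to each coefficient. Only the identities with `r = c` are needed.
  refine ⟨fun r c j => if r = c then leafCoeff α c (c.succAbove j) - η / (k + 1) else 0, ?_, ?_⟩
  · rw [hdiag fun c d => leafCoeff α c d - η / (k + 1)]
    have h1 : ∀ c : Fin (k + 1), ∑ j : Fin k, (leafCoeff α c (c.succAbove j) - η / (k + 1)) =
        ∑ d, leafCoeff α c d - k * (η / (k + 1)) := by
      intro c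
      rw [Fin.sum_univ_succAbove _ c, hleaf, zero_add, sum_sub_distrib]
      simp
    simp only [h1]
    rw [sum_sub_distrib, sum_comm]
    simp only [sum_leafCoeff (by omega) hα]
    simp only [sum_const, card_univ, Fintype.card_fin, nsmul_eq_mul]
    push_cast
    field_simp
    ring
  · intro A B
    obtain ⟨u, v, huv, hA⟩ := exists_eq_pairPartition A.2
    obtain ⟨S, w, hu, hw, hB⟩ : ∃ (S : Finset (Fin (k + 1))) (w : Fin (k + 1)),
        u ∈ S ∧ w ∉ S ∧ B.1 = cutPartition S := by
      obtain ⟨S, x, y, hx, hy, hB⟩ := exists_eq_cutPartition B.2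
      by_cases hu : u ∈ S
      · exact ⟨S, y, hu, hy, hB⟩
      · exact ⟨Sᶜ, x, mem_compl.2 hu, fun h => mem_compl.1 h hx, by rw [cutPartition_compl, hB]⟩
    let g : Fin (k + 1) → Fin (k + 1) → K := fun c d =>
      (leafCoeff α c d - η / (k + 1)) *
        if d = u then (if (c ∈ S ↔ v ∈ S) ∧ ¬ (u ∈ S ↔ v ∈ S) then 1 else 0)
        else if d = v then (if (c ∈ S ↔ u ∈ S) ∧ ¬ (u ∈ S ↔ v ∈ S) then 1 else 0) else 0
    have hg : ∀ c, g c c = 0 := by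
      intro c
      simp only [g]
      by_cases h1 : c = u
      · rw [if_pos h1, h1, if_neg (by tauto), mul_zero]
      · rw [if_neg h1]
        by_cases h2 : c = v
        · rw [if_pos h2, h2, if_neg (by tauto), mul_zero]
        · rw [if_neg h2, mul_zero]
    have h1 : ∑ r, ∑ c, ∑ j, (if r = c then leafCoeff α c (c.succAbove j) - η / (k + 1) else 0) *
        (columnL k r c j A B : K) = ∑ c, ∑ d, g c d := by
      have h2 : ∀ r c j, (if r = c then leafCoeff α c (c.succAbove j) - η / (k + 1) else 0) *
          (columnL k r c j A B : K) = if r = c then g c (c.succAbove j) else 0 := by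
        intro r c j
        by_cases hrc : r = c
        · subst hrc
          rw [if_pos rfl, if_pos rfl, columnL_self r j huv hA hB]
          simp only [g]
          push_cast
          rfl
        · rw [if_neg hrc, if_neg hrc, zero_mul]
      simp only [h2]
      rw [hdiag]
      refine sum_congr rfl fun c _ => ?_
      rw [Fin.sum_univ_succAbove (g c) c, hg, zero_add]
    have h2 : ∀ c, ∑ d, g c d = g c u + g c v := by
      intro c
      rw [← sum_pair huv]
      refine (sum_subset (subset_univ _) fun d _ hd => ?_).symm
      rw [mem_insert, mem_singleton, not_or] at hd
      simp only [g]
      rw [if_neg hd.1, if_neg hd.2, mul_zero]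
    rw [h1, ← extendCoeff_coe α, hA, hB]
    simp only [h2]
    by_cases hv : v ∈ S
    · rw [extendCoeff_eq_zero_of_mem hα hu hv hw huv]
      refine (sum_eq_zero fun c _ => ?_).symm
      simp [g, hu, hv]
    · rw [extendCoeff_eq (by omega) hα hu hv]
      have h3 : ∀ c, g c u + g c v =
          (if c ∈ S then leafCoeff α c v else leafCoeff α c u) - η / (k + 1) := by
        intro c
        by_cases hc : c ∈ S <;> simp [g, hu, hv, hc, huv.symm]
      simp only [h3]
      rw [sum_sub_distrib, ← sum_add_sum_compl S fun c => if c ∈ S then _ else _,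
        sum_congr rfl fun c (hc : c ∈ S) => if_pos hc,
        sum_congr rfl fun c (hc : c ∈ Sᶜ) => if_neg (mem_compl.1 hc)]
      congr 1
      simp only [sum_const, card_univ, Fintype.card_fin, nsmul_eq_mul]
      push_cast
      field_simp
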